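/- Let $G$ be a finite group with identity $e$, let $R$ be a commutative ring with $1$ of characteristic $0$, and for $C\subseteq G$ put $\overline{C}=\sum_{g\in C}g\in R[G]$ and $C^*=\{g^{-1}: g\in C\}$. Let $\mathcal P=\{P_0,\dots,P_d\}$ be a partition of $G$ into nonempty sets such that $\{e\}\in\mathcal P$, such that $C^*\in\mathcal P$ for all $C\in\mathcal P$, and such that for all $C,D\in\mathcal P$ the product $\overline C\cdot\overline D$ is an $R$-linear combination of the elements $\overline E$, $E\in\mathcal P$. Then $\mathfrak S=\mathrm{Span}_R\{\overline C: C\in\mathcal P\}$ is called a Schur ring over $G$ with principal sets $P_i$; assume that $\mathfrak S$ is commutative. For $0\le i\le d$ let $A_i$ be the complex $G\times G$ matrix with $(A_i)_{xy}=1$ if $yx^{-1}\in P_i$ and $(A_i)_{xy}=0$ otherwise, and let $E_i^*$ be the diagonal matrix with $(E_i^*)_{yy}=(A_i)_{ey}$ (so $(E_i^*)_{yy}=1$ if $y\in P_i$, and $0$ otherwise). Let $\mathfrak A=\mathrm{Span}_{\mathbb C}\{A_i\}$ and $\mathfrak A^*=\mathrm{Span}_{\mathbb C}\{E_i^*\}$.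 The Terwilliger algebra $T(G,\mathfrak S)$ is the subalgebra of the algebra of complex $G\times G$ matrices generated by $\mathfrak A$ and $\mathfrak A^*$. It acts on $\mathbb C^{G}$ by left multiplication. The primary module is $\mathfrak A\hat e$, where $\hat e$ is the standard basis vector at $e$. The algebra $T(G,\mathfrak S)$ is called almost commutative if every irreducible $T(G,\mathfrak S)$-submodule of $\mathbb C^{G}$ other than the primary module is $1$-dimensional. Then $T(G,\mathfrak S)$ is almost commutative if and only if the following holds: for all $x,y\in G$, if $x\in P_i$, $y\in P_j$, $xy\in P_h$ and $P_i\neq P_j^*$, then $P_iP_j=P_h$, where $P_iP_j=\{ab: a\in P_i,\ b\in P_j\}$. -/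

import Mathlib

open scoped Pointwise

/-! ### Schur rings -/

open Classical in
/-- The element `∑_{g ∈ C} g` of the group ring `R[G]`. -/
noncomputable def classSum (R : Type*) [CommRing R] {G : Type*} [Group G] [Fintype G]
    (C : Set G) : MonoidAlgebra R G :=
  ∑ g ∈ Finset.univ.filter (fun g => g ∈ C), MonoidAlgebra.single g (1 : R)

/-- A Schur ring over `R` on the finite group `G`, given by its partition `parts` of `G` into
principal sets. Here `C⁻¹ = {g⁻¹ | g ∈ C}` is the set usually written `C^*`. Membership in the
span in the last field says that the product of two class sums is an `R`-linear combination of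
class sums, whose coefficients are the structure constants. -/
structure SchurRing (R : Type*) [CommRing R] (G : Type*) [Group G] [Fintype G] where
  parts : Set (Set G)
  isPartition : Setoid.IsPartition parts
  singleton_one_mem : {(1 : G)} ∈ parts
  inv_mem : ∀ C ∈ parts, C⁻¹ ∈ parts
  mul_mem : ∀ C ∈ parts, ∀ D ∈ parts,
    classSum R C * classSum R D ∈ Submodule.span R (classSum R '' parts)

/-- The underlying set of the Schur ring, as an `R`-submodule of `R[G]`. -/
noncomputable def SchurRing.span {R : Type*} [CommRing R] {G : Type*} [Group G] [Fintype G]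
    (S : SchurRing R G) : Submodule R (MonoidAlgebra R G) :=
  Submodule.span R (classSum R '' S.parts)

/-- The Schur ring is commutative. -/
def SchurRing.IsCommutative {R : Type*} [CommRing R] {G : Type*} [Group G] [Fintype G]
    (S : SchurRing R G) : Prop :=
  ∀ a ∈ S.span, ∀ b ∈ S.span, a * b = b * a

open Classical in
/-- The adjacency matrices of the association scheme of a Schur ring, indexed by the principal
sets: the `(x, y)` entry of the matrix of `C` is `1` if `y x⁻¹ ∈ C`, and `0` otherwise. -/
noncomputable def SchurRing.adjacency {R : Type*} [CommRing R] {G : Type*} [Group G] [Fintype G]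
    (S : SchurRing R G) (C : S.parts) : Matrix G G ℂ :=
  Matrix.of fun x y => if y * x⁻¹ ∈ (C : Set G) then 1 else 0

/-! ### Terwilliger algebras

The family `A` below stands for the adjacency matrices (with entries `0` and `1`) of an
association scheme on the finite set `Ω`. -/

/-- The Bose-Mesner algebra: the linear span of the adjacency matrices. -/
def boseMesner {Ω ι : Type*} (A : ι → Matrix Ω Ω ℂ) : Submodule ℂ (Matrix Ω Ω ℂ) :=
  Submodule.span ℂ (Set.range A)

/-- The diagonal matrix `E_i^*(x)`: its `(y, y)` entry is the `(x, y)` entry of `A i`, that is,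
`1` if `x` and `y` are in the `i`-th relation and `0` otherwise. -/
def dualIdempotent {Ω ι : Type*} [DecidableEq Ω] (A : ι → Matrix Ω Ω ℂ) (x : Ω) (i : ι) :
    Matrix Ω Ω ℂ :=
  Matrix.diagonal fun y => A i x y

/-- The dual Bose-Mesner algebra with respect to the base point `x`. -/
def dualBoseMesner {Ω ι : Type*} [DecidableEq Ω] (A : ι → Matrix Ω Ω ℂ) (x : Ω) :
    Submodule ℂ (Matrix Ω Ω ℂ) :=
  Submodule.span ℂ (Set.range (dualIdempotent A x))

/-- The Terwilliger algebra `T(x)`: the subalgebra of the full matrix algebra generated by the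
Bose-Mesner algebra and the dual Bose-Mesner algebra with respect to `x`. -/
def terwilligerAlgebra {Ω ι : Type*} [Fintype Ω] [DecidableEq Ω] (A : ι → Matrix Ω Ω ℂ) (x : Ω) :
    Subalgebra ℂ (Matrix Ω Ω ℂ) :=
  Algebra.adjoin ℂ ((boseMesner A : Set (Matrix Ω Ω ℂ)) ∪ (dualBoseMesner A x))

/-- `W` is a `T`-submodule of `ℂ^Ω`, on which `T` acts by left multiplication. -/
def IsInvariantSubspace {Ω : Type*} [Fintype Ω] [DecidableEq Ω]
    (T : Subalgebra ℂ (Matrix Ω Ω ℂ)) (W : Submodule ℂ (Ω → ℂ)) : Prop :=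
  ∀ M ∈ T, ∀ w ∈ W, M.mulVec w ∈ W

/-- `W` is an irreducible `T`-submodule of `ℂ^Ω`. -/
def IsIrreducibleSubmodule {Ω : Type*} [Fintype Ω] [DecidableEq Ω]
    (T : Subalgebra ℂ (Matrix Ω Ω ℂ)) (W : Submodule ℂ (Ω → ℂ)) : Prop :=
  IsInvariantSubspace T W ∧ W ≠ ⊥ ∧
    ∀ U : Submodule ℂ (Ω → ℂ), IsInvariantSubspace T U → U ≤ W → U = ⊥ ∨ U = W

/-- The primary module: the space of all `M x̂` with `M` in the Bose-Mesner algebra, where `x̂` is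
the standard basis vector at the base point `x`. -/
def primaryModule {Ω ι : Type*} [Fintype Ω] [DecidableEq Ω] (A : ι → Matrix Ω Ω ℂ) (x : Ω) :
    Submodule ℂ (Ω → ℂ) :=
  (boseMesner A).map ((Matrix.mulVecBilin ℂ ℂ).flip (Pi.single x 1))

/-- The Terwilliger algebra with base point `x` is almost commutative: every irreducible
submodule of `ℂ^Ω` other than the primary module is one-dimensional. -/
def IsAlmostCommutative {Ω ι : Type*} [Fintype Ω] [DecidableEq Ω] (A : ι → Matrix Ω Ω ℂ) (x : Ω) :
    Prop :=
  ∀ W : Submodule ℂ (Ω → ℂ), IsIrreducibleSubmodule (terwilligerAlgebra A x) W →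
    W ≠ primaryModule A x → Module.finrank ℂ W = 1

/-! Write `N` for `primaryComplement`. Both directions pass through one criterion: for distinct
principal sets `C`, `D` and every `F`, the block `E_C^* A_F E_D^*` kills `N`. Row `x ∈ C` of this
block is the indicator of the `y ∈ D` with `y x⁻¹ ∈ F`. It kills the functions with zero sum on `D`
exactly when it is constant on `D`, that is, when `D x⁻¹` lies in `F` or misses it; this is the
condition on products. If the blocks vanish, an irreducible `W ≤ N` is supported on one principal
set, so every `E_C^*` is scalar on it; as the `A_F` commute, they are scalar too, and `W` is a line
(`HasPrincipalProducts.isAlmostCommutative`). Conversely, off-diagonal blocks vanish on invariant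
lines. The algebra is closed under conjugate transpose, so almost commutativity makes the lines in
`N` span `N`, and the blocks vanish there (`block_mulVec_eq_zero_of_isAlmostCommutative`). -/

open Matrix

/-! ### Principal sets. -/

namespace SchurRing

variable {R : Type*} [CommRing R] {G : Type*} [Group G] [Fintype G] (S : SchurRing R G)

theorem exists_part (x : G) : ∃ C : S.parts, x ∈ (C : Set G) := by
  obtain ⟨C, ⟨hC, hx⟩, -⟩ := S.isPartition.2 x
  exact ⟨⟨C, hC⟩, hx⟩

variable {S} in
theorem part_unique {C D : S.parts} {x : G} (hC : x ∈ (C : Set G)) (hD : x ∈ (D : Set G)) :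
    C = D :=
  Subtype.ext ((S.isPartition.2 x).unique ⟨C.2, hC⟩ ⟨D.2, hD⟩)

variable {S} in
theorem part_mem_iff {C : S.parts} {x y : G} (hx : x ∈ (C : Set G)) (hy : y ∈ (C : Set G))
    (D : S.parts) : x ∈ (D : Set G) ↔ y ∈ (D : Set G) :=
  ⟨fun h => part_unique hx h ▸ hy, fun h => part_unique hy h ▸ hx⟩

theorem part_nonempty (C : S.parts) : (C : Set G).Nonempty := by
  rw [Set.nonempty_iff_ne_empty]
  intro h
  exact S.isPartition.1 (h ▸ C.2)

/-- The principal set of inverses of a given principal set. -/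
def invPart (C : S.parts) : S.parts := ⟨(C : Set G)⁻¹, S.inv_mem C C.2⟩

variable {S} in
@[simp]
theorem mem_invPart {C : S.parts} {x : G} : x ∈ (S.invPart C : Set G) ↔ x⁻¹ ∈ (C : Set G) :=
  Iff.rfl

/-- The principal set of the identity. -/
def onePart : S.parts := ⟨{1}, S.singleton_one_mem⟩

variable {S} in
@[simp]
theorem mem_onePart {x : G} : x ∈ (S.onePart : Set G) ↔ x = 1 := Iff.rfl

end SchurRing

/-! ### Structure constants as factorization counts. -/

open Classical in
/-- The number of factorizations `a * b = g` with `a ∈ C` and `b ∈ D`. -/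
noncomputable def factorizationCount {G : Type*} [Group G] [Fintype G] (C D : Set G) (g : G) : ℕ :=
  (Finset.univ.filter fun a => a ∈ C ∧ a⁻¹ * g ∈ D).card

theorem factorizationCount_pos {G : Type*} [Group G] [Fintype G] {C D : Set G} {g : G} :
    0 < factorizationCount C D g ↔ ∃ a ∈ C, ∃ b ∈ D, a * b = g := by
  classical
  rw [factorizationCount, Finset.card_pos]
  constructor
  · rintro ⟨a, ha⟩
    rw [Finset.mem_filter] at ha
    exact ⟨a, ha.2.1, _, ha.2.2, by group⟩
  · rintro ⟨a, ha, b, hb, rfl⟩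
    exact ⟨a, by simp [ha, hb]⟩

open Classical in
theorem coeff_classSum (R : Type*) [CommRing R] {G : Type*} [Group G] [Fintype G] (C : Set G)
    (g : G) : (classSum R C).coeff g = if g ∈ C then 1 else 0 := by
  rw [classSum, MonoidAlgebra.coeff_sum, Finsupp.finsetSum_apply]
  simp [Finsupp.single_apply]

theorem coeff_classSum_mul (R : Type*) [CommRing R] {G : Type*} [Group G] [Fintype G]
    (C D : Set G) (g : G) :
    (classSum R C * classSum R D).coeff g = (factorizationCount C D g : R) := by
  classical
  conv_lhs => rw [classSum, Finset.sum_mul, MonoidAlgebra.coeff_sum, Finsupp.finsetSum_apply]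
  simp only [MonoidAlgebra.coeff_single_mul_apply, coeff_classSum, one_mul, factorizationCount]
  rw [← Finset.filter_filter, Finset.card_filter, Nat.cast_sum]
  exact Finset.sum_congr rfl fun a _ => by split_ifs <;> simp

namespace SchurRing

variable {R : Type*} [CommRing R] {G : Type*} [Group G] [Fintype G] {S : SchurRing R G}

theorem coeff_eq_of_mem_span {a : MonoidAlgebra R G} (ha : a ∈ S.span) {C : S.parts} {x y : G}
    (hx : x ∈ (C : Set G)) (hy : y ∈ (C : Set G)) : a.coeff x = a.coeff y := by
  induction ha using Submodule.span_induction with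
  | mem a ha =>
    obtain ⟨D, hD, rfl⟩ := ha
    classical
    rw [coeff_classSum, coeff_classSum]
    exact if_congr (part_mem_iff hx hy ⟨D, hD⟩) rfl rfl
  | zero => simp
  | add a b _ _ ha hb => simp [ha, hb]
  | smul r a _ ha => simp [ha]

/-- Characteristic zero lets an equality of coefficients in `R` be read as an equality of natural
numbers. -/
theorem factorizationCount_eq [CharZero R] (C D : S.parts) {E : S.parts} {x y : G}
    (hx : x ∈ (E : Set G)) (hy : y ∈ (E : Set G)) :
    factorizationCount (C : Set G) D x = factorizationCount (C : Set G) D y := by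
  have := coeff_eq_of_mem_span (S := S) (S.mul_mem C C.2 D D.2) hx hy
  rw [coeff_classSum_mul, coeff_classSum_mul] at this
  exact_mod_cast this

theorem IsCommutative.factorizationCount_comm [CharZero R] (hS : S.IsCommutative) (C D : S.parts)
    (g : G) : factorizationCount (C : Set G) D g = factorizationCount (D : Set G) C g := by
  have := congrArg (fun a => a.coeff g) (hS _ (Submodule.subset_span ⟨C, C.2, rfl⟩) _
    (Submodule.subset_span ⟨D, D.2, rfl⟩))
  simp only [coeff_classSum_mul] at this
  exact_mod_cast this

/-! ### Adjacency matrices and dual idempotents. -/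

open Classical in
theorem adjacency_apply (C : S.parts) (x y : G) :
    S.adjacency C x y = if y * x⁻¹ ∈ (C : Set G) then 1 else 0 := rfl

theorem adjacency_transpose (C : S.parts) : (S.adjacency C)ᵀ = S.adjacency (S.invPart C) := by
  classical
  ext x y
  rw [transpose_apply, adjacency_apply, adjacency_apply]
  exact if_congr (by simp) rfl rfl

theorem adjacency_conjTranspose (C : S.parts) :
    (S.adjacency C)ᴴ = S.adjacency (S.invPart C) := by
  ext x y
  rw [conjTranspose_apply, ← adjacency_transpose, transpose_apply, adjacency_apply]
  split_ifs <;> simp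

theorem adjacency_mul_apply (C D : S.parts) (x z : G) :
    (S.adjacency C * S.adjacency D) x z = (factorizationCount (D : Set G) C (z * x⁻¹) : ℂ) := by
  classical
  rw [mul_apply, factorizationCount, Finset.card_filter, Nat.cast_sum]
  -- Put `a = z y⁻¹`: then `z x⁻¹ = (z y⁻¹)(y x⁻¹)`, with left factor in `D` and right factor in
  -- `C`, whence the reversed order.
  refine Fintype.sum_equiv ((Equiv.inv G).trans (Equiv.mulLeft z)) _ _ fun y => ?_
  by_cases h₁ : y * x⁻¹ ∈ (C : Set G) <;> by_cases h₂ : z * y⁻¹ ∈ (D : Set G) <;>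
    simp [adjacency_apply, h₁, h₂]

theorem IsCommutative.adjacency_comm [CharZero R] (hS : S.IsCommutative) (C D : S.parts) :
    S.adjacency C * S.adjacency D = S.adjacency D * S.adjacency C := by
  ext x z
  rw [adjacency_mul_apply, adjacency_mul_apply, hS.factorizationCount_comm]

variable [DecidableEq G]

open Classical in
theorem dualIdempotent_mulVec (C : S.parts) (f : G → ℂ) (x : G) :
    (dualIdempotent S.adjacency 1 C *ᵥ f) x = if x ∈ (C : Set G) then f x else 0 := by
  simp [dualIdempotent, mulVec_diagonal, adjacency_apply]

theorem dualIdempotent_transpose (C : S.parts) :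
    (dualIdempotent S.adjacency 1 C)ᵀ = dualIdempotent S.adjacency 1 C :=
  diagonal_transpose _

theorem dualIdempotent_conjTranspose (C : S.parts) :
    (dualIdempotent S.adjacency 1 C)ᴴ = dualIdempotent S.adjacency 1 C := by
  rw [dualIdempotent, diagonal_conjTranspose]
  congr 1
  ext y
  simp only [Pi.star_apply, adjacency_apply]
  split_ifs <;> simp

theorem adjacency_mem_terwilligerAlgebra (C : S.parts) :
    S.adjacency C ∈ terwilligerAlgebra S.adjacency (1 : G) :=
  Algebra.subset_adjoin (Or.inl (Submodule.subset_span ⟨C, rfl⟩))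

theorem dualIdempotent_mem_terwilligerAlgebra (C : S.parts) :
    dualIdempotent S.adjacency 1 C ∈ terwilligerAlgebra S.adjacency (1 : G) :=
  Algebra.subset_adjoin (Or.inr (Submodule.subset_span ⟨C, rfl⟩))

end SchurRing

/-! ### Adjoints and invariant subspaces. -/

theorem star_dotProduct_mulVec_eq {Ω : Type*} [Fintype Ω] (M : Matrix Ω Ω ℂ) (w f : Ω → ℂ) :
    star w ⬝ᵥ (M *ᵥ f) = star (Mᴴ *ᵥ w) ⬝ᵥ f := by
  rw [star_mulVec, conjTranspose_conjTranspose, dotProduct_mulVec]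

theorem span_mulVec_mem {Ω : Type*} [Fintype Ω] {s : Set (Matrix Ω Ω ℂ)}
    {W : Submodule ℂ (Ω → ℂ)} (h : ∀ M ∈ s, ∀ w ∈ W, M *ᵥ w ∈ W) {M : Matrix Ω Ω ℂ}
    (hM : M ∈ Submodule.span ℂ s) : ∀ w ∈ W, M *ᵥ w ∈ W := by
  induction hM using Submodule.span_induction with
  | mem M hM => exact h M hM
  | zero => simp
  | add M N _ _ hM hN =>
    intro w hw
    rw [add_mulVec]
    exact W.add_mem (hM w hw) (hN w hw)
  | smul c M _ hM =>
    intro w hw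
    rw [smul_mulVec]
    exact W.smul_mem c (hM w hw)

theorem isInvariantSubspace_terwilligerAlgebra {Ω ι : Type*} [Fintype Ω] [DecidableEq Ω]
    {A : ι → Matrix Ω Ω ℂ} {x : Ω} {W : Submodule ℂ (Ω → ℂ)}
    (hA : ∀ i, ∀ w ∈ W, A i *ᵥ w ∈ W) (hE : ∀ i, ∀ w ∈ W, dualIdempotent A x i *ᵥ w ∈ W) :
    IsInvariantSubspace (terwilligerAlgebra A x) W := by
  intro M hM
  induction hM using Algebra.adjoin_induction with
  | mem M hM =>
    rcases hM with hM | hM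
    · exact span_mulVec_mem (by rintro _ ⟨i, rfl⟩; exact hA i) hM
    · exact span_mulVec_mem (by rintro _ ⟨i, rfl⟩; exact hE i) hM
  | algebraMap r =>
    intro w hw
    rw [Algebra.algebraMap_eq_smul_one, smul_mulVec, one_mulVec]
    exact W.smul_mem r hw
  | add M N _ _ hM hN =>
    intro w hw
    rw [add_mulVec]
    exact W.add_mem (hM w hw) (hN w hw)
  | mul M N _ _ hM hN =>
    intro w hw
    rw [← mulVec_mulVec]
    exact hM _ (hN w hw)

theorem mem_primaryModule {Ω ι : Type*} [Fintype Ω] [DecidableEq Ω] {A : ι → Matrix Ω Ω ℂ} {x : Ω}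
    {f : Ω → ℂ} : f ∈ primaryModule A x ↔ ∃ M ∈ boseMesner A, M *ᵥ Pi.single x 1 = f := by
  simp [primaryModule, Submodule.mem_map]

theorem IsInvariantSubspace.exists_irreducible {Ω : Type*} [Fintype Ω] [DecidableEq Ω]
    {T : Subalgebra ℂ (Matrix Ω Ω ℂ)} {Q : Submodule ℂ (Ω → ℂ)} (hQ : IsInvariantSubspace T Q)
    (h0 : Q ≠ ⊥) : ∃ W ≤ Q, IsIrreducibleSubmodule T W := by
  obtain ⟨W, ⟨hWT, hWQ, hW0⟩, hmin⟩ := WellFounded.has_min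
    (wellFounded_lt : WellFounded ((· < ·) : Submodule ℂ (Ω → ℂ) → Submodule ℂ (Ω → ℂ) → Prop))
    {W | IsInvariantSubspace T W ∧ W ≤ Q ∧ W ≠ ⊥} ⟨Q, hQ, le_rfl, h0⟩
  refine ⟨W, hWQ, hWT, hW0, fun U hU hUW => ?_⟩
  by_contra! h
  exact hmin U ⟨hU, hUW.trans hWQ, h.1⟩ (lt_of_le_of_ne hUW h.2)

/-! ### The primary module. -/

namespace SchurRing

variable {R : Type*} [CommRing R] {G : Type*} [Group G] [Fintype G] [DecidableEq G]
  {S : SchurRing R G}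

theorem adjacency_mulVec_single_mem (C : S.parts) :
    S.adjacency C *ᵥ Pi.single 1 1 ∈ primaryModule S.adjacency (1 : G) :=
  mem_primaryModule.2 ⟨_, Submodule.subset_span ⟨C, rfl⟩, rfl⟩

open Classical in
theorem adjacency_mulVec_single (C : S.parts) (x : G) :
    (S.adjacency C *ᵥ Pi.single 1 1) x = if x ∈ (S.invPart C : Set G) then 1 else 0 := by
  simp [adjacency_apply]

theorem primaryModule_eq_span : primaryModule S.adjacency (1 : G) =
    Submodule.span ℂ (Set.range fun C => S.adjacency C *ᵥ Pi.single 1 1) := by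
  rw [primaryModule, boseMesner, Submodule.map_span, ← Set.range_comp]
  rfl

/-- The primary module consists of the functions that are constant on the principal sets. -/
theorem mem_primaryModule_iff {f : G → ℂ} : f ∈ primaryModule S.adjacency (1 : G) ↔
    ∀ C : S.parts, ∀ x ∈ (C : Set G), ∀ y ∈ (C : Set G), f x = f y := by
  classical
  rw [primaryModule_eq_span]
  constructor
  · intro hf C x hx y hy
    induction hf using Submodule.span_induction with
    | mem f hf =>
      obtain ⟨D, rfl⟩ := hf
      simp only [adjacency_mulVec_single, part_mem_iff hx hy (S.invPart D)]
    | zero => rfl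
    | add f g _ _ hf hg => simp [hf, hg]
    | smul c f _ hf => simp [hf]
  · intro hf
    have : f = ∑ C : S.parts, f (S.part_nonempty C).some •
        (S.adjacency (S.invPart C) *ᵥ Pi.single 1 1) := by
      ext x
      obtain ⟨C, hC⟩ := S.exists_part x
      simp only [Finset.sum_apply, Pi.smul_apply, adjacency_mulVec_single, mem_invPart, inv_inv]
      rw [Finset.sum_eq_single C]
      · simp [hC, hf C x hC _ (S.part_nonempty C).some_mem]
      · intro D _ hD
        rw [if_neg fun h => hD (part_unique h hC), smul_zero]
      · simp
    rw [this]
    exact Submodule.sum_mem _ fun C _ => Submodule.smul_mem _ _ (Submodule.subset_span ⟨_, rfl⟩)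

theorem adjacency_mulVec_mem_primaryModule [CharZero R] (C : S.parts) :
    ∀ f ∈ primaryModule S.adjacency (1 : G),
      S.adjacency C *ᵥ f ∈ primaryModule S.adjacency (1 : G) := by
  intro f hf
  rw [primaryModule_eq_span] at hf
  induction hf using Submodule.span_induction with
  | mem f hf =>
    obtain ⟨D, rfl⟩ := hf
    refine mem_primaryModule_iff.2 fun E x hx y hy => ?_
    rw [mulVec_mulVec, mulVec_single_one, col_apply, col_apply, adjacency_mul_apply,
      adjacency_mul_apply]
    exact congrArg _ (factorizationCount_eq D C (E := S.invPart E) (by simpa) (by simpa))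
  | zero => simp
  | add f g _ _ hf hg =>
    rw [mulVec_add]
    exact Submodule.add_mem _ hf hg
  | smul c f _ hf =>
    rw [mulVec_smul]
    exact Submodule.smul_mem _ c hf

theorem dualIdempotent_mulVec_mem_primaryModule (C : S.parts) :
    ∀ f ∈ primaryModule S.adjacency (1 : G),
      dualIdempotent S.adjacency 1 C *ᵥ f ∈ primaryModule S.adjacency (1 : G) := by
  intro f hf
  refine mem_primaryModule_iff.2 fun E x hx y hy => ?_
  classical
  rw [dualIdempotent_mulVec, dualIdempotent_mulVec]
  exact if_congr (part_mem_iff hx hy C) (mem_primaryModule_iff.1 hf E x hx y hy) rfl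

theorem primaryModule_isInvariantSubspace [CharZero R] :
    IsInvariantSubspace (terwilligerAlgebra S.adjacency (1 : G)) (primaryModule S.adjacency 1) :=
  isInvariantSubspace_terwilligerAlgebra adjacency_mulVec_mem_primaryModule
    dualIdempotent_mulVec_mem_primaryModule

theorem single_mem_primaryModule : Pi.single 1 1 ∈ primaryModule S.adjacency (1 : G) := by
  convert adjacency_mulVec_single_mem S.onePart using 1
  ext x
  classical
  simp [adjacency_mulVec_single, Pi.single_apply]

/-! ### The complement of the primary module. -/

variable (S) in
/-- The orthogonal complement of the primary module: the functions whose sum over every principal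
set vanishes. -/
def primaryComplement : Submodule ℂ (G → ℂ) where
  carrier := {f | ∀ u ∈ primaryModule S.adjacency (1 : G), u ⬝ᵥ f = 0}
  zero_mem' := by simp
  add_mem' hf hg u hu := by rw [dotProduct_add, hf u hu, hg u hu, add_zero]
  smul_mem' c f hf u hu := by rw [dotProduct_smul, hf u hu, smul_zero]

/-- The generators are closed under transposition and preserve the primary module. -/
theorem primaryComplement_isInvariantSubspace [CharZero R] :
    IsInvariantSubspace (terwilligerAlgebra S.adjacency (1 : G)) S.primaryComplement := by
  refine isInvariantSubspace_terwilligerAlgebra (fun C f hf u hu => ?_) (fun C f hf u hu => ?_)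
  · rw [dotProduct_mulVec, ← mulVec_transpose, adjacency_transpose]
    exact hf _ (adjacency_mulVec_mem_primaryModule _ _ hu)
  · rw [dotProduct_mulVec, ← mulVec_transpose, dualIdempotent_transpose]
    exact hf _ (dualIdempotent_mulVec_mem_primaryModule _ _ hu)

theorem primaryModule_not_le_primaryComplement :
    ¬ primaryModule S.adjacency (1 : G) ≤ S.primaryComplement := by
  intro h
  have := h single_mem_primaryModule _ single_mem_primaryModule
  simp at this

open Classical in
theorem sum_eq_zero_of_mem_primaryComplement {f : G → ℂ} (hf : f ∈ S.primaryComplement)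
    (C : S.parts) : ∑ y, (if y ∈ (C : Set G) then f y else 0) = 0 := by
  have := hf _ (adjacency_mulVec_single_mem (S.invPart C))
  simpa [dotProduct, adjacency_mulVec_single] using this

/-- An irreducible submodule other than the primary module is orthogonal to it. -/
theorem le_primaryComplement_of_irreducible [CharZero R] {W : Submodule ℂ (G → ℂ)}
    (hW : IsIrreducibleSubmodule (terwilligerAlgebra S.adjacency (1 : G)) W)
    (hne : W ≠ primaryModule S.adjacency (1 : G)) : W ≤ S.primaryComplement := by
  -- The basis vector at `1` generates the primary module, so an irreducible `W` containing it would
  -- equal that module.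
  have hsingle : (Pi.single 1 1 : G → ℂ) ∉ W := by
    intro h
    have hle : primaryModule S.adjacency (1 : G) ≤ W := by
      rw [primaryModule_eq_span, Submodule.span_le]
      rintro _ ⟨C, rfl⟩
      exact hW.1 _ (adjacency_mem_terwilligerAlgebra C) _ h
    rcases hW.2.2 _ primaryModule_isInvariantSubspace hle with h0 | h0
    · exact primaryModule_not_le_primaryComplement (h0 ▸ bot_le)
    · exact hne h0.symm
  intro w hw u hu
  rw [primaryModule_eq_span] at hu
  induction hu using Submodule.span_induction with
  | mem u hu =>
    obtain ⟨C, rfl⟩ := hu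
    by_contra hc
    set c := (S.adjacency C *ᵥ Pi.single 1 1) ⬝ᵥ w with hcdef
    refine hsingle ?_
    -- Projecting `A_{C⁻¹} w` to the coordinate `1` leaves `c` times the basis vector there, since
    -- row `1` of `A_{C⁻¹}` is `A_C` applied to that vector.
    have hv := W.smul_mem c⁻¹ (hW.1 _ (dualIdempotent_mem_terwilligerAlgebra S.onePart) _
      (hW.1 _ (adjacency_mem_terwilligerAlgebra (S.invPart C)) _ hw))
    convert hv using 1
    ext x
    have h1 : (S.adjacency (S.invPart C) *ᵥ w) 1 = c := by
      rw [hcdef, ← adjacency_transpose]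
      rw [mulVec_single_one]
      rfl
    rw [Pi.smul_apply, dualIdempotent_mulVec]
    by_cases hx : x = 1
    · subst hx
      simp [h1, hc]
    · simp [hx]
  | zero => simp
  | add f g _ _ hf hg => rw [add_dotProduct, hf, hg, add_zero]
  | smul c f _ hf => rw [smul_dotProduct, hf, smul_zero]

/-! ### Off-diagonal blocks; products of principal sets imply almost commutativity. -/

open Classical in
theorem block_mulVec (C D F : S.parts) (f : G → ℂ) (x : G) :
    ((dualIdempotent S.adjacency 1 C * S.adjacency F * dualIdempotent S.adjacency 1 D) *ᵥ f) x =
      if x ∈ (C : Set G) then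
        ∑ y, (if y * x⁻¹ ∈ (F : Set G) ∧ y ∈ (D : Set G) then f y else 0) else 0 := by
  rw [← mulVec_mulVec, ← mulVec_mulVec, dualIdempotent_mulVec]
  congr 1
  simp only [mulVec, dotProduct, adjacency_apply]
  refine Finset.sum_congr rfl fun y _ => ?_
  have := dualIdempotent_mulVec D f y
  simp only [mulVec, dotProduct] at this
  rw [this]
  split_ifs <;> simp_all

variable (S) in
/-- Products of two principal sets that are not inverse to each other are principal sets. -/
def HasPrincipalProducts : Prop :=
  ∀ x y : G, ∀ P_i ∈ S.parts, ∀ P_j ∈ S.parts, ∀ P_h ∈ S.parts,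
    x ∈ P_i → y ∈ P_j → x * y ∈ P_h → P_i ≠ P_j⁻¹ → P_i * P_j = P_h

/-- If one `y ∈ D` has `y x⁻¹ ∈ F`, then `D C⁻¹ = F`, so all of `D` does: each row sum is empty or
the full sum of `f` over `D`, which is zero. -/
theorem HasPrincipalProducts.block_mulVec_eq_zero (h : S.HasPrincipalProducts) {C D : S.parts}
    (hCD : C ≠ D) (F : S.parts) {f : G → ℂ} (hf : f ∈ S.primaryComplement) :
    (dualIdempotent S.adjacency 1 C * S.adjacency F * dualIdempotent S.adjacency 1 D) *ᵥ f = 0 := by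
  classical
  ext x
  rw [block_mulVec, Pi.zero_apply]
  split_ifs with hx
  · by_cases hy : ∃ y ∈ (D : Set G), y * x⁻¹ ∈ (F : Set G)
    · obtain ⟨y, hyD, hyF⟩ := hy
      have hprod := h y x⁻¹ D D.2 _ (S.invPart C).2 F F.2 hyD (by simpa) hyF (by
        change (D : Set G) ≠ ((C : Set G)⁻¹)⁻¹
        rw [inv_inv]
        exact fun h => hCD (Subtype.ext h.symm))
      refine (Finset.sum_congr rfl fun z _ => ?_).trans (sum_eq_zero_of_mem_primaryComplement hf D)
      exact if_congr (and_iff_right_of_imp fun hz => hprod ▸ Set.mul_mem_mul hz (by simpa)) rfl rfl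
    · refine Finset.sum_eq_zero fun y _ => if_neg fun hy' => hy ⟨y, hy'.2, hy'.1⟩
  · rfl

theorem HasPrincipalProducts.isAlmostCommutative [CharZero R] (hS : S.IsCommutative)
    (h : S.HasPrincipalProducts) : IsAlmostCommutative S.adjacency (1 : G) := by
  classical
  intro W hW hne
  have hWN := le_primaryComplement_of_irreducible hW hne
  obtain ⟨w, hwW, hw0⟩ := W.ne_bot_iff.1 hW.2.1
  obtain ⟨a, ha⟩ := Function.ne_iff.1 hw0
  obtain ⟨D, haD⟩ := S.exists_part a
  -- The vectors of `W` supported on `D` form a nonzero submodule: with the blocks zero, no `A_F`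
  -- moves them off `D`.
  have hE : ∀ f ∈ W, ∀ x ∉ (D : Set G), f x = 0 := by
    let U : Submodule ℂ (G → ℂ) :=
      { carrier := {f | f ∈ W ∧ ∀ x ∉ (D : Set G), f x = 0}
        zero_mem' := ⟨W.zero_mem, fun _ _ => rfl⟩
        add_mem' := fun hf hg => ⟨W.add_mem hf.1 hg.1, fun x hx => by simp [hf.2 x hx, hg.2 x hx]⟩
        smul_mem' := fun c f hf => ⟨W.smul_mem c hf.1, fun x hx => by simp [hf.2 x hx]⟩ }
    have hUW : U ≤ W := fun f hf => hf.1
    have hU : IsInvariantSubspace (terwilligerAlgebra S.adjacency (1 : G)) U := by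
      refine isInvariantSubspace_terwilligerAlgebra (fun F f hf => ?_) (fun C f hf => ?_)
      · refine ⟨hW.1 _ (adjacency_mem_terwilligerAlgebra F) _ hf.1, fun x hx => ?_⟩
        obtain ⟨C, hxC⟩ := S.exists_part x
        have hCD : C ≠ D := by rintro rfl; exact hx hxC
        have h0 := congrFun (h.block_mulVec_eq_zero hCD F (hWN hf.1)) x
        have hDf : dualIdempotent S.adjacency 1 D *ᵥ f = f := by
          ext y
          rw [dualIdempotent_mulVec]
          split_ifs with hy
          · rfl
          · exact (hf.2 y hy).symm
        rwa [← mulVec_mulVec, hDf, ← mulVec_mulVec, dualIdempotent_mulVec, if_pos hxC] at h0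
      · refine ⟨hW.1 _ (dualIdempotent_mem_terwilligerAlgebra C) _ hf.1, fun x hx => ?_⟩
        rw [dualIdempotent_mulVec, hf.2 x hx, ite_self]
    have hUne : U ≠ ⊥ := by
      refine U.ne_bot_iff.2 ⟨dualIdempotent S.adjacency 1 D *ᵥ w,
        ⟨hW.1 _ (dualIdempotent_mem_terwilligerAlgebra D) _ hwW, fun x hx => ?_⟩, fun h0 => ha ?_⟩
      · rw [dualIdempotent_mulVec, if_neg hx]
      · have := congrFun h0 a
        rwa [dualIdempotent_mulVec, if_pos haD] at this
    intro f hf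
    rw [← (hW.2.2 U hU hUW).resolve_left hUne] at hf
    exact hf.2
  have hEsmul : ∀ C : S.parts, ∃ c : ℂ, ∀ f ∈ W, dualIdempotent S.adjacency 1 C *ᵥ f = c • f := by
    intro C
    by_cases hC : C = D
    · refine ⟨1, fun f hf => ?_⟩
      ext x
      rw [dualIdempotent_mulVec, one_smul]
      split_ifs with hx
      · rfl
      · exact (hE f hf x (hC ▸ hx)).symm
    · refine ⟨0, fun f hf => ?_⟩
      ext x
      rw [dualIdempotent_mulVec, zero_smul, Pi.zero_apply]
      split_ifs with hx
      · exact hE f hf x fun hx' => hC (part_unique hx hx')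
      · rfl
  have hAsmul : ∀ F : S.parts, ∃ c : ℂ, ∀ f ∈ W, S.adjacency F *ᵥ f = c • f := by
    intro F
    have : Nontrivial W := ⟨⟨⟨w, hwW⟩, 0, fun h => hw0 (congrArg Subtype.val h)⟩⟩
    obtain ⟨c, hc⟩ := Module.End.exists_eigenvalue ((mulVecLin (S.adjacency F)).restrict
      (p := W) (q := W) (hW.1 _ (adjacency_mem_terwilligerAlgebra F)))
    obtain ⟨v, hv⟩ := hc.exists_hasEigenvector
    have hv1 : S.adjacency F *ᵥ (v : G → ℂ) = c • (v : G → ℂ) :=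
      congrArg Subtype.val hv.apply_eq_smul
    refine ⟨c, ?_⟩
    -- The eigenspace of `A_F` in `W` is a submodule, because the `A_C` commute with `A_F` and the
    -- dual idempotents are scalar on `W`.
    let U : Submodule ℂ (G → ℂ) :=
      { carrier := {f | f ∈ W ∧ S.adjacency F *ᵥ f = c • f}
        zero_mem' := ⟨W.zero_mem, by simp⟩
        add_mem' := fun hf hg => ⟨W.add_mem hf.1 hg.1, by rw [mulVec_add, hf.2, hg.2, smul_add]⟩
        smul_mem' := fun r f hf =>
          ⟨W.smul_mem r hf.1, by rw [mulVec_smul, hf.2, smul_comm]⟩ }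
    have hU : IsInvariantSubspace (terwilligerAlgebra S.adjacency (1 : G)) U := by
      refine isInvariantSubspace_terwilligerAlgebra (fun C f hf => ?_) (fun C f hf => ?_)
      · refine ⟨hW.1 _ (adjacency_mem_terwilligerAlgebra C) _ hf.1, ?_⟩
        rw [mulVec_mulVec, hS.adjacency_comm, ← mulVec_mulVec, hf.2, mulVec_smul]
      · obtain ⟨r, hr⟩ := hEsmul C
        rw [hr f hf.1]
        exact U.smul_mem r hf
    have hUne : U ≠ ⊥ :=
      U.ne_bot_iff.2 ⟨v, ⟨v.2, hv1⟩, fun h0 => hv.2 (Subtype.ext h0)⟩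
    intro f hf
    rw [← (hW.2.2 U hU fun f hf => hf.1).resolve_left hUne] at hf
    exact hf.2
  have hline : IsInvariantSubspace (terwilligerAlgebra S.adjacency (1 : G))
      (Submodule.span ℂ {w}) := by
    have hle : Submodule.span ℂ {w} ≤ W := by simpa [Submodule.span_le] using hwW
    refine isInvariantSubspace_terwilligerAlgebra (fun C f hf => ?_) (fun C f hf => ?_)
    · obtain ⟨c, hc⟩ := hAsmul C
      rw [hc f (hle hf)]
      exact Submodule.smul_mem _ c hf
    · obtain ⟨c, hc⟩ := hEsmul C
      rw [hc f (hle hf)]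
      exact Submodule.smul_mem _ c hf
  rcases hW.2.2 _ hline (by simpa [Submodule.span_le] using hwW) with h0 | h0
  · exact absurd (Submodule.span_singleton_eq_bot.1 h0) hw0
  · rw [← h0, finrank_span_singleton hw0]

/-! ### Almost commutativity implies the condition on products. -/

/-- On a line all three factors are scalars, and `E_C^* E_D^* = 0` forces the product of the outer
two to vanish. -/
theorem block_mulVec_eq_zero_of_finrank_eq_one {W : Submodule ℂ (G → ℂ)}
    (hW : IsInvariantSubspace (terwilligerAlgebra S.adjacency (1 : G)) W)
    (h1 : Module.finrank ℂ W = 1) {C D : S.parts} (hCD : C ≠ D) (F : S.parts) {f : G → ℂ}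
    (hf : f ∈ W) :
    (dualIdempotent S.adjacency 1 C * S.adjacency F * dualIdempotent S.adjacency 1 D) *ᵥ f = 0 := by
  classical
  have hmem : ∀ M ∈ terwilligerAlgebra S.adjacency (1 : G), ∃ c : ℂ, ∀ f ∈ W, M *ᵥ f = c • f := by
    intro M hM
    obtain ⟨v, -, hv⟩ := finrank_eq_one_iff'.1 h1
    obtain ⟨c, hc⟩ := hv ⟨_, hW M hM v v.2⟩
    refine ⟨c, fun f hf => ?_⟩
    obtain ⟨r, hr⟩ := hv ⟨f, hf⟩
    have hr' : r • (v : G → ℂ) = f := congrArg Subtype.val hr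
    have hc' : c • (v : G → ℂ) = M *ᵥ (v : G → ℂ) := congrArg Subtype.val hc
    rw [← hr', mulVec_smul, ← hc', smul_comm]
  obtain ⟨c, hc⟩ := hmem _ (dualIdempotent_mem_terwilligerAlgebra C)
  obtain ⟨d, hd⟩ := hmem _ (dualIdempotent_mem_terwilligerAlgebra D)
  obtain ⟨r, hr⟩ := hmem _ (adjacency_mem_terwilligerAlgebra F)
  have h0 : dualIdempotent S.adjacency 1 C *ᵥ (dualIdempotent S.adjacency 1 D *ᵥ f) = 0 := by
    ext x
    rw [dualIdempotent_mulVec, dualIdempotent_mulVec]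
    split_ifs with hx hx'
    · exact absurd (part_unique hx hx') hCD
    · rfl
    · rfl
  rw [hd f hf, mulVec_smul, hc f hf] at h0
  rw [← mulVec_mulVec, ← mulVec_mulVec, hd f hf, mulVec_smul, hr f hf, mulVec_smul, mulVec_smul,
    hc f hf, smul_comm d r, h0, smul_zero]

variable (S) in
/-- The vectors of the complement of the primary module that are orthogonal to all of its
one-dimensional submodules. -/
def lineComplement : Submodule ℂ (G → ℂ) where
  carrier := {f | f ∈ S.primaryComplement ∧ ∀ W : Submodule ℂ (G → ℂ),
    IsInvariantSubspace (terwilligerAlgebra S.adjacency (1 : G)) W → W ≤ S.primaryComplement →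
    Module.finrank ℂ W = 1 → ∀ w ∈ W, star w ⬝ᵥ f = 0}
  zero_mem' := ⟨Submodule.zero_mem _, by simp⟩
  add_mem' hf hg := ⟨Submodule.add_mem _ hf.1 hg.1, fun W h₁ h₂ h₃ w hw => by
    rw [dotProduct_add, hf.2 W h₁ h₂ h₃ w hw, hg.2 W h₁ h₂ h₃ w hw, add_zero]⟩
  smul_mem' c f hf := ⟨Submodule.smul_mem _ c hf.1, fun W h₁ h₂ h₃ w hw => by
    rw [dotProduct_smul, hf.2 W h₁ h₂ h₃ w hw, smul_zero]⟩

theorem lineComplement_isInvariantSubspace [CharZero R] :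
    IsInvariantSubspace (terwilligerAlgebra S.adjacency (1 : G)) S.lineComplement := by
  refine isInvariantSubspace_terwilligerAlgebra (fun C f hf => ?_) (fun C f hf => ?_)
  · refine ⟨primaryComplement_isInvariantSubspace _ (adjacency_mem_terwilligerAlgebra C) _ hf.1,
      fun W h₁ h₂ h₃ w hw => ?_⟩
    rw [star_dotProduct_mulVec_eq, adjacency_conjTranspose]
    exact hf.2 W h₁ h₂ h₃ _ (h₁ _ (adjacency_mem_terwilligerAlgebra _) _ hw)
  · refine ⟨primaryComplement_isInvariantSubspace _ (dualIdempotent_mem_terwilligerAlgebra C) _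
      hf.1, fun W h₁ h₂ h₃ w hw => ?_⟩
    rw [star_dotProduct_mulVec_eq, dualIdempotent_conjTranspose]
    exact hf.2 W h₁ h₂ h₃ _ (h₁ _ (dualIdempotent_mem_terwilligerAlgebra _) _ hw)

open scoped ComplexOrder in
-- Otherwise it would contain an irreducible submodule, which is a line in `N` and hence orthogonal
-- to itself.
theorem lineComplement_eq_bot [CharZero R] (h : IsAlmostCommutative S.adjacency (1 : G)) :
    S.lineComplement = ⊥ := by
  by_contra h0
  obtain ⟨W, hWQ, hW⟩ := lineComplement_isInvariantSubspace.exists_irreducible h0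
  have hWN : W ≤ S.primaryComplement := fun w hw => (hWQ hw).1
  have h1 := h W hW (by rintro rfl; exact primaryModule_not_le_primaryComplement hWN)
  refine hW.2.1 (W.eq_bot_iff.2 fun w hw => ?_)
  exact dotProduct_star_self_eq_zero.1 ((hWQ hw).2 W hW.1 hWN h1 w hw)

open scoped ComplexOrder in
theorem block_mulVec_eq_zero_of_isAlmostCommutative [CharZero R]
    (h : IsAlmostCommutative S.adjacency (1 : G)) {C D : S.parts} (hCD : C ≠ D) (F : S.parts)
    {f : G → ℂ} (hf : f ∈ S.primaryComplement) :
    (dualIdempotent S.adjacency 1 C * S.adjacency F * dualIdempotent S.adjacency 1 D) *ᵥ f = 0 := by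
  set B := dualIdempotent S.adjacency 1 C * S.adjacency F * dualIdempotent S.adjacency 1 D with hB
  have hBT : B ∈ terwilligerAlgebra S.adjacency (1 : G) :=
    MulMemClass.mul_mem (MulMemClass.mul_mem (dualIdempotent_mem_terwilligerAlgebra C)
      (adjacency_mem_terwilligerAlgebra F)) (dualIdempotent_mem_terwilligerAlgebra D)
  have hBHT : Bᴴ ∈ terwilligerAlgebra S.adjacency (1 : G) := by
    rw [hB, conjTranspose_mul, conjTranspose_mul, dualIdempotent_conjTranspose,
      dualIdempotent_conjTranspose, adjacency_conjTranspose]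
    exact MulMemClass.mul_mem (dualIdempotent_mem_terwilligerAlgebra D)
      (MulMemClass.mul_mem (adjacency_mem_terwilligerAlgebra _) (dualIdempotent_mem_terwilligerAlgebra C))
  -- `B` kills every invariant line, so the image of `Bᴴ` is orthogonal to all of them. Then `Bᴴ B f
  -- = 0`, and the norm of `B f` is zero.
  have hg : Bᴴ *ᵥ (B *ᵥ f) ∈ S.lineComplement := by
    refine ⟨primaryComplement_isInvariantSubspace _ hBHT _
      (primaryComplement_isInvariantSubspace _ hBT _ hf), fun W h₁ h₂ h₃ w hw => ?_⟩
    rw [star_dotProduct_mulVec_eq, conjTranspose_conjTranspose,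
      block_mulVec_eq_zero_of_finrank_eq_one h₁ h₃ hCD F hw, star_zero, zero_dotProduct]
  rw [lineComplement_eq_bot h, Submodule.mem_bot] at hg
  have h0 : star (B *ᵥ f) ⬝ᵥ (B *ᵥ f) = 0 := by
    have := star_dotProduct_mulVec_eq Bᴴ f (B *ᵥ f)
    rwa [hg, dotProduct_zero, conjTranspose_conjTranspose, eq_comm] at this
  exact dotProduct_star_self_eq_zero.1 h0

theorem single_sub_single_mem_primaryComplement {C : S.parts} {a b : G} (ha : a ∈ (C : Set G))
    (hb : b ∈ (C : Set G)) :
    (Pi.single a 1 - Pi.single b 1 : G → ℂ) ∈ S.primaryComplement := by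
  intro u hu
  simp [dotProduct_sub, mem_primaryModule_iff.1 hu C a ha b hb]

/-- Row `y⁻¹` of the block from `D` to `C⁻¹`, applied to the difference of the basis vectors at `a`
and `b`, gives the difference of the two indicators. -/
theorem mul_mem_iff_of_isAlmostCommutative [CharZero R]
    (h : IsAlmostCommutative S.adjacency (1 : G)) {C D : S.parts} (hCD : D ≠ S.invPart C)
    (F : S.parts) {a b y : G} (ha : a ∈ (D : Set G)) (hb : b ∈ (D : Set G))
    (hy : y ∈ (C : Set G)) : a * y ∈ (F : Set G) ↔ b * y ∈ (F : Set G) := by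
  classical
  have h0 := congrFun (block_mulVec_eq_zero_of_isAlmostCommutative h hCD.symm F
    (single_sub_single_mem_primaryComplement ha hb)) y⁻¹
  rw [block_mulVec, if_pos (by simpa), Pi.zero_apply] at h0
  have hsum : ∀ c ∈ (D : Set G), ∑ z, (if z * (y⁻¹)⁻¹ ∈ (F : Set G) ∧ z ∈ (D : Set G) then
      (Pi.single c 1 : G → ℂ) z else 0) = if c * y ∈ (F : Set G) then 1 else 0 := by
    intro c hc
    rw [Finset.sum_eq_single c]
    · simp [hc]
    · intro z _ hz
      simp [hz]
    · simp
  have hsplit := Finset.sum_sub_distrib (s := Finset.univ)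
    (fun z => if z * (y⁻¹)⁻¹ ∈ (F : Set G) ∧ z ∈ (D : Set G) then
      (Pi.single a 1 : G → ℂ) z else 0)
    (fun z => if z * (y⁻¹)⁻¹ ∈ (F : Set G) ∧ z ∈ (D : Set G) then
      (Pi.single b 1 : G → ℂ) z else 0)
  rw [hsum a ha, hsum b hb] at hsplit
  have heq : (if a * y ∈ (F : Set G) then (1 : ℂ) else 0) -
      (if b * y ∈ (F : Set G) then 1 else 0) = 0 := by
    rw [← hsplit, ← h0]
    refine Finset.sum_congr rfl fun z _ => ?_
    split_ifs <;> simp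
  by_cases h₁ : a * y ∈ (F : Set G) <;> by_cases h₂ : b * y ∈ (F : Set G) <;> simp_all

theorem hasPrincipalProducts_of_isAlmostCommutative [CharZero R]
    (h : IsAlmostCommutative S.adjacency (1 : G)) : S.HasPrincipalProducts := by
  intro x y P hP Q hQ F hF hx hy hxy hPQ
  have hPQ' : (⟨P, hP⟩ : S.parts) ≠ S.invPart ⟨Q, hQ⟩ := fun h => hPQ (congrArg Subtype.val h)
  have hQP : S.invPart ⟨Q, hQ⟩ ≠ S.invPart (S.invPart ⟨P, hP⟩) := by
    intro h
    refine hPQ' (h.trans ?_).symm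
    exact Subtype.ext (inv_inv P)
  apply Set.Subset.antisymm
  · rintro _ ⟨a, ha, b, hb, rfl⟩
    change a * b ∈ F
    have hay := (mul_mem_iff_of_isAlmostCommutative h hPQ' ⟨F, hF⟩ hx ha hy).1 hxy
    -- Taking inverses turns the change of the right factor from `y` to `b` into a change of the
    -- left factor.
    have := mul_mem_iff_of_isAlmostCommutative h hQP (S.invPart ⟨F, hF⟩)
      (a := y⁻¹) (b := b⁻¹) (y := a⁻¹) (by simpa) (by simpa) (by simpa)
    simp only [mem_invPart, _root_.mul_inv_rev, inv_inv] at this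
    exact this.1 hay
  · intro g hg
    -- The number of factorizations is constant on `F` and positive at `x y`.
    have hpos := factorizationCount_pos.2 ⟨x, hx, y, hy, rfl⟩
    rw [factorizationCount_eq (S := S) ⟨P, hP⟩ ⟨Q, hQ⟩ (E := ⟨F, hF⟩) hxy hg,
      factorizationCount_pos] at hpos
    obtain ⟨a, ha, b, hb, rfl⟩ := hpos
    exact Set.mul_mem_mul ha hb

end SchurRing

theorem theorem2p2 {R : Type*} [CommRing R] [CharZero R]
    {G : Type*} [Group G] [Fintype G] [DecidableEq G]
    (S : SchurRing R G) (hS : S.IsCommutative) :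
    IsAlmostCommutative S.adjacency (1 : G) ↔
      ∀ x y : G, ∀ P_i ∈ S.parts, ∀ P_j ∈ S.parts, ∀ P_h ∈ S.parts,
        x ∈ P_i → y ∈ P_j → x * y ∈ P_h → P_i ≠ P_j⁻¹ → P_i * P_j = P_h :=
  ⟨SchurRing.hasPrincipalProducts_of_isAlmostCommutative,
    SchurRing.HasPrincipalProducts.isAlmostCommutative hS⟩
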